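/- Write $\mathbb{R}^3_\pm=\{x\in\mathbb{R}^3:\pm x_3>0\}$, $\Delta_h=\partial_1^2+\partial_2^2$, and let $\gamma_\pm:W^{1,2}(\mathbb{R}^3_\pm)\to L^2(\mathbb{R}^2)$ be the trace operators onto the interface $\{x_3=0\}\cong\mathbb{R}^2$. All functions are real-valued. Let $\kappa_A,\kappa_B,\tilde\kappa_S,\alpha_S>0$ and $T\in(0,\infty)$. Let $\theta_0^A\in W^{1,2}(\mathbb{R}^3_+)$, $\theta_0^B\in W^{1,2}(\mathbb{R}^3_-)$, $\theta_0^S\in W^{1,2}(\mathbb{R}^2)$ satisfy $\gamma_+[\theta_0^A]=\theta_0^S=\gamma_-[\theta_0^B]$. Call $(\theta_A,\theta_B,\theta_S)$ a strong solution on $[0,T)$ with initial data $(\theta_0^A,\theta_0^B,\theta_0^S)$ if, with $\Omega=\mathbb{R}^3_+,\mathbb{R}^3_-,\mathbb{R}^2$ respectively, each of $\theta_A,\theta_B,\theta_S$ belongs to $$C([0,T);L^2(\Omega))\cap L^2(0,T;W^{2,2}(\Omega))\cap W^{1,2}(0,T;L^2(\Omega))\cap L^2((0,T)\times\Omega),$$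 the equations $$\begin{cases}\partial_t\theta_A=\kappa_A\Delta\theta_A & \text{in }\mathbb{R}^3_+,\\ \partial_t\theta_B=\kappa_B\Delta\theta_B & \text{in }\mathbb{R}^3_-,\\ \alpha_S\,\partial_t\theta_S=\tilde\kappa_S\alpha_S\,\Delta_h\theta_S+\kappa_A\gamma_+[\partial_3\theta_A]-\kappa_B\gamma_-[\partial_3\theta_B] & \text{in }\mathbb{R}^2,\\ \gamma_+[\theta_A]=\gamma_-[\theta_B]=\theta_S & \text{in }\mathbb{R}^2\end{cases}$$ hold for almost every $t\in(0,T)$ (derivatives being weak derivatives), $\theta_A,\theta_B,\theta_S$ tend to $0$ (up to null sets) as $|x|\to\infty$ in their domains for almost every $t\in(0,T)$, and $\theta_A(0)=\theta_0^A$, $\theta_B(0)=\theta_0^B$, $\theta_S(0)=\theta_0^S$. If $(\theta_A^\sharp,\theta_B^\sharp,\theta_S^\sharp)$ and $(\theta_A^\flat,\theta_B^\flat,\theta_S^\flat)$ are two strong solutions on $[0,T)$ with the same initial data $(\theta_0^A,\theta_0^B,\theta_0^S)$, then $\theta_A^\sharp(t)=\theta_A^\flat(t)$, $\theta_B^\sharp(t)=\theta_B^\flat(t)$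 and $\theta_S^\sharp(t)=\theta_S^\flat(t)$ for all $t\in[0,T)$. -/

import Mathlib

open MeasureTheory Set Filter Topology
open scoped ContDiff ENNReal

noncomputable section

namespace ThreePhaseHeat

/-! ## Domains and Lebesgue spaces -/

/-- Euclidean space `ℝⁿ`. -/
abbrev Euc (n : ℕ) : Type := EuclideanSpace ℝ (Fin n)

/-- The upper half space `{x ∈ ℝ³ : x₃ > 0}`; the coordinates `x₁, x₂, x₃` carry the indices
`0, 1, 2`. -/
def upperHalf : Set (Euc 3) := {x | 0 < x 2}

/-- The lower half space `{x ∈ ℝ³ : x₃ < 0}`. -/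
def lowerHalf : Set (Euc 3) := {x | x 2 < 0}

/-- The whole plane `ℝ²`, as a domain. -/
def plane : Set (Euc 2) := univ

/-- The point `(x_h, 0)` of the interface `{x₃ = 0}` that corresponds to `x_h ∈ ℝ²`. -/
def interfacePt (y : Euc 2) : Euc 3 := !₂[y 0, y 1, 0]

/-- The real Hilbert space `L²(Ω)`. -/
abbrev L2 {n : ℕ} (Ω : Set (Euc n)) : Type := Lp ℝ 2 (volume.restrict Ω)

/-- The classical partial derivative `∂ᵢ φ`. -/
def partialDeriv {n : ℕ} (i : Fin n) (φ : Euc n → ℝ) (x : Euc n) : ℝ :=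
  fderiv ℝ φ x (EuclideanSpace.single i 1)

/-! ## Weak derivatives and Sobolev spaces in the space variable -/

/-- `v ∈ L²(Ω)` is the weak partial derivative `∂ᵢ u` of `u ∈ L²(Ω)` in the open set `Ω`. -/
def HasWeakPartial {n : ℕ} (Ω : Set (Euc n)) (i : Fin n) (u v : L2 Ω) : Prop :=
  ∀ φ : Euc n → ℝ, ContDiff ℝ ∞ φ → HasCompactSupport φ → tsupport φ ⊆ Ω →
    ∫ x in Ω, u x * partialDeriv i φ x = - ∫ x in Ω, v x * φ x

open Classical in
/-- The weak partial derivative `∂ᵢ u ∈ L²(Ω)` (with value `0` if there is none in `L²(Ω)`; it is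
only used for functions that have one). -/
def weakPartial {n : ℕ} (Ω : Set (Euc n)) (i : Fin n) (u : L2 Ω) : L2 Ω :=
  if h : ∃ v, HasWeakPartial Ω i u v then h.choose else 0

/-- `u ∈ W^{1,2}(Ω)`. -/
def MemW12 {n : ℕ} (Ω : Set (Euc n)) (u : L2 Ω) : Prop :=
  ∀ i, ∃ v, HasWeakPartial Ω i u v

/-- `u ∈ W^{2,2}(Ω)`. -/
def MemW22 {n : ℕ} (Ω : Set (Euc n)) (u : L2 Ω) : Prop :=
  MemW12 Ω u ∧ ∀ i, MemW12 Ω (weakPartial Ω i u)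

/-- The Laplacian `Δ u = ∑ᵢ ∂ᵢ ∂ᵢ u` of `u ∈ W^{2,2}(Ω)`. -/
def laplacian {n : ℕ} (Ω : Set (Euc n)) (u : L2 Ω) : L2 Ω :=
  ∑ i, weakPartial Ω i (weakPartial Ω i u)

/-- `γ[u] = g` for `u ∈ W^{1,2}(Ω)`, `g ∈ L²(ℝ²)`, where `Ω` is one of the two half spaces of `ℝ³`
and `γ : W^{1,2}(Ω) → L²(ℝ²)` is the trace operator, that is, the unique continuous extension of
the restriction `φ ↦ φ(·, 0)`, defined for the functions `φ ∈ C_c^∞(ℝ³)`, whose restrictions to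
`Ω` are dense in `W^{1,2}(Ω)`. The graph of this extension is the closure of the graph of the
restriction map, and this is what is written out here. -/
def HasTrace (Ω : Set (Euc 3)) (u : L2 Ω) (g : L2 plane) : Prop :=
  MemW12 Ω u ∧
  ∃ φ : ℕ → Euc 3 → ℝ,
    (∀ m, ContDiff ℝ ∞ (φ m) ∧ HasCompactSupport (φ m)) ∧
    Tendsto (fun m => eLpNorm (fun x => φ m x - u x) 2 (volume.restrict Ω)) atTop (𝓝 0) ∧
    (∀ i, Tendsto (fun m => eLpNorm (fun x => partialDeriv i (φ m) x - weakPartial Ω i u x) 2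
      (volume.restrict Ω)) atTop (𝓝 0)) ∧
    Tendsto (fun m => eLpNorm (fun y => φ m (interfacePt y) - g y) 2 (volume.restrict plane))
      atTop (𝓝 0)

/-! ## Spaces of functions of time with values in `L²(Ω)` -/

/-- `θ'` is the weak derivative of the vector-valued function `θ` on the time interval `(0,T)`. -/
def HasWeakTimeDeriv {F : Type*} [NormedAddCommGroup F] [NormedSpace ℝ F]
    (T : ℝ) (θ θ' : ℝ → F) : Prop :=
  ∀ φ : ℝ → ℝ, ContDiff ℝ ∞ φ → HasCompactSupport φ → tsupport φ ⊆ Ioo 0 T →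
    ∫ t in Ioo 0 T, deriv φ t • θ t = - ∫ t in Ioo 0 T, φ t • θ' t

/-- `θ ∈ L²(0,T; F)` (Bochner space). -/
def MemL2Time {F : Type*} [NormedAddCommGroup F] (T : ℝ) (θ : ℝ → F) : Prop :=
  MemLp θ 2 (volume.restrict (Ioo 0 T))

/-- `θ ∈ W^{1,2}(0,T; F)`. -/
def MemW12Time {F : Type*} [NormedAddCommGroup F] [NormedSpace ℝ F]
    (T : ℝ) (θ : ℝ → F) : Prop :=
  MemL2Time T θ ∧ ∃ θ', MemL2Time T θ' ∧ HasWeakTimeDeriv T θ θ'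

open Classical in
/-- The time derivative `∂ₜ θ ∈ L²(0,T; F)` of `θ ∈ W^{1,2}(0,T; F)`. -/
def timeDeriv {F : Type*} [NormedAddCommGroup F] [NormedSpace ℝ F]
    (T : ℝ) (θ : ℝ → F) : ℝ → F :=
  if h : MemW12Time T θ then h.2.choose else 0

/-- `θ ∈ L²(0,T; W^{2,2}(Ω))`. As `W^{2,2}(Ω)` is normed by the `L²` norms of the function and of
its weak derivatives of order one and two, measurability and square integrability of a function
with values in `W^{2,2}(Ω)` are those of the function and of these derivatives as functions with
values in `L²(Ω)`. -/
def MemL2W22 {n : ℕ} (Ω : Set (Euc n)) (T : ℝ) (θ : ℝ → L2 Ω) : Prop :=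
  (∀ᵐ t ∂volume.restrict (Ioo 0 T), MemW22 Ω (θ t)) ∧
  MemL2Time T θ ∧
  (∀ i, MemL2Time T (fun t => weakPartial Ω i (θ t))) ∧
  (∀ i j, MemL2Time T (fun t => weakPartial Ω j (weakPartial Ω i (θ t))))

/-- `θ ∈ L²((0,T) × Ω)`: the slices `θ(t)` come from a square integrable function of `(t,x)`. -/
def MemL2SpaceTime {n : ℕ} (Ω : Set (Euc n)) (T : ℝ) (θ : ℝ → L2 Ω) : Prop :=
  ∃ f : ℝ × Euc n → ℝ,
    MemLp f 2 ((volume.restrict (Ioo 0 T)).prod (volume.restrict Ω)) ∧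
    ∀ᵐ t ∂volume.restrict (Ioo 0 T), ∀ᵐ x ∂volume.restrict Ω, θ t x = f (t, x)

/-- The regularity class
`C([0,T); L²(Ω)) ∩ L²(0,T; W^{2,2}(Ω)) ∩ W^{1,2}(0,T; L²(Ω)) ∩ L²((0,T) × Ω)`. -/
structure InRegularityClass {n : ℕ} (Ω : Set (Euc n)) (T : ℝ) (θ : ℝ → L2 Ω) : Prop where
  continuousOn : ContinuousOn θ (Ico 0 T)
  memL2W22 : MemL2W22 Ω T θ
  memW12Time : MemW12Time T θ
  memL2SpaceTime : MemL2SpaceTime Ω T θ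

/-- `lim_{|x| → ∞, x ∈ Ω} u(x) = 0`, up to null sets. -/
def VanishesAtInfinity {n : ℕ} (Ω : Set (Euc n)) (u : L2 Ω) : Prop :=
  ∀ ε : ℝ, 0 < ε → ∃ R : ℝ, ∀ᵐ x ∂volume.restrict Ω, R < ‖x‖ → |u x| < ε

/-! ## The heat system in the two half spaces and the interface -/

/-- `(θA, θB, θS)`, in the regularity class, is a strong solution on `[0,T)` of the system
`∂ₜ θA = κA Δ θA` in the upper half space, `∂ₜ θB = κB Δ θB` in the lower half space,
`αS ∂ₜ θS = κS Δ_h θS + κA γ₊[∂₃ θA] - κB γ₋[∂₃ θB]` and `γ₊[θA] = γ₋[θB] = θS` on the interface,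
with vanishing limits at infinity and with initial data `(θA₀, θB₀, θS₀)`. -/
structure IsStrongSolution (κA κB κS αS T : ℝ)
    (θA₀ : L2 upperHalf) (θB₀ : L2 lowerHalf) (θS₀ : L2 plane)
    (θA : ℝ → L2 upperHalf) (θB : ℝ → L2 lowerHalf) (θS : ℝ → L2 plane) : Prop where
  regA : InRegularityClass upperHalf T θA
  regB : InRegularityClass lowerHalf T θB
  regS : InRegularityClass plane T θS
  eqA : ∀ᵐ t ∂volume.restrict (Ioo 0 T), timeDeriv T θA t = κA • laplacian upperHalf (θA t)
  eqB : ∀ᵐ t ∂volume.restrict (Ioo 0 T), timeDeriv T θB t = κB • laplacian lowerHalf (θB t)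
  eqS : ∀ᵐ t ∂volume.restrict (Ioo 0 T), ∃ gA gB : L2 plane,
    HasTrace upperHalf (weakPartial upperHalf 2 (θA t)) gA ∧
    HasTrace lowerHalf (weakPartial lowerHalf 2 (θB t)) gB ∧
    αS • timeDeriv T θS t = κS • laplacian plane (θS t) + κA • gA - κB • gB
  traceA : ∀ᵐ t ∂volume.restrict (Ioo 0 T), HasTrace upperHalf (θA t) (θS t)
  traceB : ∀ᵐ t ∂volume.restrict (Ioo 0 T), HasTrace lowerHalf (θB t) (θS t)
  decayA : ∀ᵐ t ∂volume.restrict (Ioo 0 T), VanishesAtInfinity upperHalf (θA t)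
  decayB : ∀ᵐ t ∂volume.restrict (Ioo 0 T), VanishesAtInfinity lowerHalf (θB t)
  decayS : ∀ᵐ t ∂volume.restrict (Ioo 0 T), VanishesAtInfinity plane (θS t)
  initA : θA 0 = θA₀
  initB : θB 0 = θB₀
  initS : θS 0 = θS₀

end ThreePhaseHeat

end

open ThreePhaseHeat

/-! The argument is an energy estimate. Let `a`, `b`, `w` be the differences of the two solutions in
the upper half space, in the lower half space and on the interface, and let `E = ‖a‖² + ‖b‖² + αS
‖w‖²`. Then `E(0) = 0`. Pairing the equations with `a`, `b`, `w` and integrating by parts, `E'/2` is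
minus the three weighted Dirichlet energies plus boundary terms. The outward normals of the half
spaces are `∓e₃`, so the bulk contributes `-κA ⟨w, γ₊[∂₃a]⟩ + κB ⟨w, γ₋[∂₃b]⟩`, both traces of the
solutions being `w`. The flux terms of the interface equation are exactly the opposite. Hence `E ≤
0`, and all differences vanish at every time.

Two points need care at this regularity. In time, `norm_sq_eq_two_integral_inner` gives the
integrated energy identity: du Bois-Reymond makes a continuous function with square integrable weak
derivative a primitive, and Fubini integrates by parts. In space, `green_halfSpace` rests on
approximation by test functions for the vertical direction and on a cut-off near the boundary for
the horizontal ones. On the plane, integration by parts follows by differentiating the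
translation-invariant `L²` pairing (`inner_weakPartial_whole`). -/

noncomputable section

namespace ThreePhaseHeat

/-! ## Absolutely continuous functions of time -/

/-- Integration by parts for two primitives and a continuous bilinear map. -/
theorem integral_bilin_primitive {E F G : Type*} [NormedAddCommGroup E] [NormedSpace ℝ E]
    [NormedAddCommGroup F] [NormedSpace ℝ F] [NormedAddCommGroup G] [NormedSpace ℝ G]
    [CompleteSpace E] [CompleteSpace F] [CompleteSpace G]
    (B : E →L[ℝ] F →L[ℝ] G) (μ : Measure ℝ) [SFinite μ] [NullSingletonClass μ] {f : ℝ → E} {g : ℝ → F}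
    (hf : Integrable f μ) (hg : Integrable g μ) :
    (∫ t, B (∫ s in Iio t, f s ∂μ) (g t) ∂μ) + ∫ t, B (f t) (∫ s in Iio t, g s ∂μ) ∂μ
      = B (∫ t, f t ∂μ) (∫ t, g t ∂μ) := by
  -- Both terms integrate this one kernel, over the two sides of the diagonal of the square;
  -- together they give the integral over the whole square, which factorises.
  set K : ℝ × ℝ → G := fun z => B (f z.1) (g z.2) with hK
  have hKi : Integrable K (μ.prod μ) :=
    hf.op_fst_snd (op := fun x y => B x y) (by fun_prop) ⟨‖B‖, B.le_opNorm₂⟩ hg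
  have hS : MeasurableSet {z : ℝ × ℝ | z.1 < z.2} := measurableSet_lt measurable_fst measurable_snd
  have h1 : ∫ z in {z : ℝ × ℝ | z.1 < z.2}, K z ∂(μ.prod μ)
      = ∫ t, B (∫ s in Iio t, f s ∂μ) (g t) ∂μ := by
    rw [← integral_indicator hS, integral_prod_symm _ (hKi.indicator hS)]
    refine integral_congr_ae (.of_forall fun t => ?_)
    have : (fun s => indicator {z : ℝ × ℝ | z.1 < z.2} K (s, t))
        = (Iio t).indicator (fun s => B (f s) (g t)) := by
      ext s; simp [indicator, hK]
    simp only [this]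
    rw [integral_indicator measurableSet_Iio]
    exact (B.flip (g t)).integral_comp_comm hf.integrableOn
  have h2 : ∫ z in {z : ℝ × ℝ | z.1 < z.2}ᶜ, K z ∂(μ.prod μ)
      = ∫ t, B (f t) (∫ s in Iio t, g s ∂μ) ∂μ := by
    rw [← integral_indicator hS.compl, integral_prod _ (hKi.indicator hS.compl)]
    refine integral_congr_ae (.of_forall fun t => ?_)
    have : (fun s => indicator {z : ℝ × ℝ | z.1 < z.2}ᶜ K (t, s))
        = (Iic t).indicator (fun s => B (f t) (g s)) := by
      ext s; simp [indicator, hK]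
    simp only [this]
    rw [integral_indicator measurableSet_Iic, integral_Iic_eq_integral_Iio]
    exact (B (f t)).integral_comp_comm hg.integrableOn
  rw [← h1, ← h2, integral_add_compl hS hKi, integral_prod _ hKi]
  have h3 : ∀ t, ∫ s, K (t, s) ∂μ = B (f t) (∫ s, g s ∂μ) := fun t =>
    (B (f t)).integral_comp_comm hg
  simp only [h3]
  exact (B.flip (∫ s, g s ∂μ)).integral_comp_comm hf

theorem restrict_Ioo_restrict_Iio {T t : ℝ} (ht : t ≤ T) :
    (volume.restrict (Ioo 0 T)).restrict (Iio t) = volume.restrict (Ioo 0 t) := by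
  rw [Measure.restrict_restrict measurableSet_Iio]
  congr 1
  ext x
  simp only [mem_inter_iff, mem_Iio, mem_Ioo]
  constructor
  · rintro ⟨h1, h2, h3⟩; exact ⟨h2, h1⟩
  · rintro ⟨h1, h2⟩; exact ⟨h2, h1, h2.trans_le ht⟩

/-- The primitive of an integrable function is weakly differentiable in time. -/
theorem hasWeakTimeDeriv_primitive {F : Type*} [NormedAddCommGroup F] [NormedSpace ℝ F]
    [CompleteSpace F] {T : ℝ} {f : ℝ → F} (hf : Integrable f (volume.restrict (Ioo 0 T))) :
    HasWeakTimeDeriv T (fun t => ∫ s in Ioo 0 t, f s) f := by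
  intro φ hφ hφc hφs
  have hdc : Continuous (deriv φ) := hφ.continuous_deriv (by simp)
  have hdi : Integrable (deriv φ) (volume.restrict (Ioo 0 T)) :=
    (hdc.integrable_of_hasCompactSupport hφc.deriv).integrableOn
  have hφ0 : ∀ t, t ∉ Ioo 0 T → φ t = 0 := fun t ht =>
    image_eq_zero_of_notMem_tsupport (fun h => ht (hφs h))
  have hprim : ∀ t, 0 ≤ t → ∫ s in Ioo 0 t, deriv φ s = φ t := by
    intro t ht
    rw [← integral_Ioc_eq_integral_Ioo, ← intervalIntegral.integral_of_le ht,
      intervalIntegral.integral_deriv_eq_sub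
        (fun x _ => (hφ.differentiable (by simp)).differentiableAt)
        (hdc.intervalIntegrable _ _), hφ0 0 (by simp), sub_zero]
  rcases le_or_gt T 0 with hT | hT
  · simp [Ioo_eq_empty_of_le hT]
  -- Here `φ` is the primitive of `deriv φ`, and the boundary term vanishes because `φ T = 0`.
  have key := integral_bilin_primitive (ContinuousLinearMap.lsmul ℝ ℝ (E := F))
    (volume.restrict (Ioo 0 T)) hdi hf
  simp only [ContinuousLinearMap.lsmul_apply] at key
  rw [hprim T hT.le, hφ0 T (by simp), zero_smul] at key
  have e1 : ∫ t in Ioo 0 T, (∫ s in Iio t, deriv φ s ∂(volume.restrict (Ioo 0 T))) • f t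
      = ∫ t in Ioo 0 T, φ t • f t := by
    refine setIntegral_congr_fun measurableSet_Ioo fun t ht => ?_
    simp only [restrict_Ioo_restrict_Iio ht.2.le, hprim t ht.1.le]
  have e2 : ∫ t in Ioo 0 T, deriv φ t • (∫ s in Iio t, f s ∂(volume.restrict (Ioo 0 T)))
      = ∫ t in Ioo 0 T, deriv φ t • (∫ s in Ioo 0 t, f s) := by
    refine setIntegral_congr_fun measurableSet_Ioo fun t ht => ?_
    simp only [restrict_Ioo_restrict_Iio ht.2.le]
  rw [e1, e2] at key
  exact eq_neg_of_add_eq_zero_right key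

/-- A smooth function with compact support in `(0,T)` and vanishing integral is the derivative of
such a function. -/
theorem exists_deriv_eq_of_integral_eq_zero {T : ℝ} {g : ℝ → ℝ} (hg : ContDiff ℝ ∞ g)
    {a b : ℝ} (ha : 0 < a) (hab : a ≤ b) (hb : b < T) (hgs : ∀ x, x ∉ Icc a b → g x = 0)
    (hg0 : ∫ x, g x = 0) :
    ∃ φ : ℝ → ℝ, ContDiff ℝ ∞ φ ∧ HasCompactSupport φ ∧ tsupport φ ⊆ Ioo 0 T ∧ deriv φ = g := by
  set φ : ℝ → ℝ := fun x => ∫ t in (0 : ℝ)..x, g t with hφ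
  have hd : deriv φ = g := funext fun x => hg.continuous.deriv_integral g 0 x
  have hdiff : Differentiable ℝ φ := fun x =>
    (hg.continuous.integral_hasStrictDerivAt 0 x).hasDerivAt.differentiableAt
  have hz : ∀ x, x ∉ Icc a b → φ x = 0 := by
    intro x hx
    rcases lt_or_ge x a with h | h
    · refine intervalIntegral.integral_zero_ae (.of_forall fun t ht => hgs t fun ht' => ?_)
      have := ht.2
      rcases le_max_iff.1 this with h' | h' <;> linarith [ht'.1]
    -- Beyond `b` the primitive has collected the whole integral of `g`, which is zero.
    · have hbx : b < x := not_le.1 fun h' => hx ⟨h, h'⟩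
      rw [hφ, ← hg0]
      simp only
      rw [intervalIntegral.integral_of_le (by linarith)]
      refine setIntegral_eq_integral_of_forall_compl_eq_zero fun t ht => hgs t fun ht' => ht ?_
      exact ⟨by linarith [ht'.1], by linarith [ht'.2]⟩
  have hsub : tsupport φ ⊆ Icc a b :=
    closure_minimal (fun x hx => by_contra fun h => hx (hz x h)) isClosed_Icc
  refine ⟨φ, contDiff_infty_iff_deriv.2 ⟨hdiff, hd ▸ hg⟩,
    isCompact_Icc.of_isClosed_subset (isClosed_tsupport _) hsub,
    hsub.trans fun x hx => ⟨by linarith [hx.1], by linarith [hx.2]⟩, hd⟩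

/-- The du Bois-Reymond lemma for vector-valued functions. -/
theorem ae_eq_const_of_hasWeakTimeDeriv_zero {F : Type*} [NormedAddCommGroup F] [NormedSpace ℝ F]
    [CompleteSpace F] {T : ℝ} (hT : 0 < T) {w : ℝ → F}
    (hw : Integrable w (volume.restrict (Ioo 0 T))) (h : HasWeakTimeDeriv T w 0) :
    ∃ c, ∀ᵐ t ∂volume.restrict (Ioo 0 T), w t = c := by
  let ρ : ContDiffBump (T / 2) := ⟨T / 8, T / 4, by linarith, by linarith⟩
  set r : ℝ → ℝ := ρ.normed volume with hr
  have hrd : ContDiff ℝ ∞ r := ρ.contDiff_normed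
  have hrc : HasCompactSupport r := ρ.hasCompactSupport_normed
  have hri : ∫ x, r x = 1 := ρ.integral_normed
  have hrs : tsupport r ⊆ Ioo 0 T := by
    rw [hr, ρ.tsupport_normed_eq, Real.closedBall_eq_Icc]
    intro x hx
    have h1 := hx.1; have h2 := hx.2
    simp only [ρ] at h1 h2
    constructor <;> linarith
  have hrne : (tsupport r).Nonempty := by
    rw [hr, ρ.tsupport_normed_eq]; exact ⟨T / 2, by simp [ρ]; linarith⟩
  -- Since `r` has integral one, its weighted mean of `w` is the only possible value of the
  -- constant.
  set c := ∫ t in Ioo 0 T, r t • w t with hc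
  have hsm : ∀ p : ℝ → ℝ, ContDiff ℝ ∞ p → HasCompactSupport p →
      Integrable (fun t => p t • w t) (volume.restrict (Ioo 0 T)) := by
    intro p hp hpc
    obtain ⟨C, hC⟩ := hp.continuous.bounded_above_of_compact_support hpc
    exact hw.bdd_smul C hp.continuous.aestronglyMeasurable (.of_forall hC)
  refine ⟨c, ?_⟩
  have key : ∀ᵐ t, t ∈ Ioo 0 T → w t - c = 0 := by
    refine isOpen_Ioo.ae_eq_zero_of_integral_contDiff_smul_eq_zero ?_ ?_
    · have hw' : LocallyIntegrableOn w (Ioo 0 T) := IntegrableOn.locallyIntegrableOn hw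
      exact hw'.sub ((locallyIntegrable_const c).locallyIntegrableOn _)
    intro ψ hψ hψc hψs
    set m := ∫ x, ψ x with hm
    set K := tsupport r ∪ tsupport ψ with hKdef
    have hK : IsCompact K := hrc.isCompact.union hψc.isCompact
    have hKne : K.Nonempty := hrne.mono subset_union_left
    have hKs : K ⊆ Ioo 0 T := union_subset hrs hψs
    have hKI : K ⊆ Icc (sInf K) (sSup K) := fun x hx =>
      ⟨csInf_le hK.bddBelow hx, le_csSup hK.bddAbove hx⟩
    -- Subtracting `m * r` removes the mean of `ψ`, so the result is an admissible derivative;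
    -- testing with its primitive gives `∫ ψ w = m c`.
    obtain ⟨φ, hφ, hφc, hφs, hφd⟩ := exists_deriv_eq_of_integral_eq_zero (T := T)
      (g := fun x => ψ x - m * r x) (hψ.sub (contDiff_const.mul hrd))
      (hKs (hK.sInf_mem hKne)).1 ((hKI (hK.sInf_mem hKne)).2) (hKs (hK.sSup_mem hKne)).2
      (fun x hx => by
        have hx' : x ∉ K := fun h => hx (hKI h)
        simp only [hKdef, mem_union, not_or] at hx'
        simp [image_eq_zero_of_notMem_tsupport hx'.1, image_eq_zero_of_notMem_tsupport hx'.2])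
      (by
        rw [integral_sub (hψ.continuous.integrable_of_hasCompactSupport hψc)
          ((hrd.continuous.integrable_of_hasCompactSupport hrc).const_mul m),
          integral_const_mul, hri, mul_one, sub_self])
    have h0 := h φ hφ hφc hφs
    rw [hφd] at h0
    have e1 : ∫ t, ψ t • (w t - c) = ∫ t in Ioo 0 T, ψ t • (w t - c) := by
      refine (setIntegral_eq_integral_of_forall_compl_eq_zero fun t ht => ?_).symm
      rw [image_eq_zero_of_notMem_tsupport (fun h => ht (hψs h)), zero_smul]
    have e2 : ∫ t in Ioo 0 T, ψ t = m :=
      setIntegral_eq_integral_of_forall_compl_eq_zero fun t ht =>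
        image_eq_zero_of_notMem_tsupport (fun h => ht (hψs h))
    have hψi : Integrable ψ (volume.restrict (Ioo 0 T)) :=
      (hψ.continuous.integrable_of_hasCompactSupport hψc).integrableOn
    rw [e1]
    simp only [smul_sub]
    rw [integral_sub (hsm ψ hψ hψc) (hψi.smul_const c), integral_smul_const, e2]
    simp only [sub_smul, mul_smul] at h0
    have h1 : Integrable (fun t => m • r t • w t) (volume.restrict (Ioo 0 T)) :=
      (hsm r hrd hrc).smul m
    rw [integral_sub (hsm ψ hψ hψc) h1, integral_smul, ← hc] at h0
    simpa using h0
  rw [ae_restrict_iff' measurableSet_Ioo]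
  filter_upwards [key] with t ht ht'
  exact sub_eq_zero.1 (ht ht')

theorem MemL2Time.integrable {F : Type*} [NormedAddCommGroup F] {T : ℝ} {f : ℝ → F}
    (hf : MemL2Time T f) : Integrable f (volume.restrict (Ioo 0 T)) :=
  MemLp.integrable (by norm_num) hf

theorem continuousOn_primitive_Ico {F : Type*} [NormedAddCommGroup F] [NormedSpace ℝ F]
    {T : ℝ} {f : ℝ → F} (hf : Integrable f (volume.restrict (Ioo 0 T))) :
    ContinuousOn (fun t => ∫ s in Ioo 0 t, f s) (Ico 0 T) := by
  have hf' : IntegrableOn f (Icc 0 T) := integrableOn_Icc_iff_integrableOn_Ioo (by simp) (by simp) |>.2 hf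
  refine ((intervalIntegral.continuousOn_primitive hf').mono Ico_subset_Icc_self).congr
    fun t _ => ?_
  exact integral_Ioc_eq_integral_Ioo.symm

/-- A continuous function with a square integrable weak time derivative is the primitive of it. -/
theorem eq_add_primitive {F : Type*} [NormedAddCommGroup F] [NormedSpace ℝ F]
    [CompleteSpace F] {T : ℝ} (hT : 0 < T) {θ θ' : ℝ → F} (hc : ContinuousOn θ (Ico 0 T))
    (hθ : MemL2Time T θ) (hθ' : MemL2Time T θ') (h : HasWeakTimeDeriv T θ θ') :
    ∀ t ∈ Ico 0 T, θ t = θ 0 + ∫ s in Ioo 0 t, θ' s := by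
  set P : ℝ → F := fun t => ∫ s in Ioo 0 t, θ' s with hP
  have hPc : ContinuousOn P (Ico 0 T) := continuousOn_primitive_Ico hθ'.integrable
  have hPi : Integrable P (volume.restrict (Ioo 0 T)) := by
    have hf' : IntegrableOn θ' (Icc 0 T) := integrableOn_Icc_iff_integrableOn_Ioo (by simp) (by simp) |>.2 hθ'.integrable
    have hc' : ContinuousOn P (Icc 0 T) :=
      (intervalIntegral.continuousOn_primitive hf').congr
        fun t _ => integral_Ioc_eq_integral_Ioo.symm
    exact hc'.integrableOn_Icc.mono_set Ioo_subset_Icc_self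
  have hPd := hasWeakTimeDeriv_primitive hθ'.integrable
  have hsm : ∀ p : ℝ → ℝ, ContDiff ℝ ∞ p → HasCompactSupport p → ∀ w : ℝ → F,
      Integrable w (volume.restrict (Ioo 0 T)) →
      Integrable (fun t => deriv p t • w t) (volume.restrict (Ioo 0 T)) := by
    intro p hp hpc w hw
    have hdc : Continuous (deriv p) := hp.continuous_deriv (by simp)
    obtain ⟨C, hC⟩ := hdc.bounded_above_of_compact_support hpc.deriv
    exact hw.bdd_smul C hdc.aestronglyMeasurable (.of_forall hC)
  obtain ⟨c, hcc⟩ := ae_eq_const_of_hasWeakTimeDeriv_zero hT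
    (w := fun t => θ t - P t) (hθ.integrable.sub hPi) (by
      intro φ hφ hφc hφs
      simp only [smul_sub]
      rw [integral_sub (hsm φ hφ hφc _ hθ.integrable) (hsm φ hφ hφc _ hPi), h φ hφ hφc hφs,
        hPd φ hφ hφc hφs]
      simp)
  -- Continuity upgrades the almost everywhere identity to all of `[0,T)`, including the endpoint
  -- `0`, where it identifies `c` as `θ 0`.
  have heq : EqOn (fun t => θ t - P t) (fun _ => c) (Ico 0 T) := by
    refine Measure.eqOn_of_ae_eq (μ := volume) ?_ (hc.sub hPc) continuousOn_const ?_
    · rw [← restrict_Ioo_eq_restrict_Ico]; exact hcc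
    · rw [interior_Ico, closure_Ioo hT.ne]; exact Ico_subset_Icc_self
  have h0 : θ 0 = c := by simpa [hP] using heq ⟨le_rfl, hT⟩
  intro t ht
  have := heq ht
  change θ t - P t = c at this
  rw [h0, ← this]; simp [hP]

/-- The energy identity for a function of time with values in a Hilbert space. -/
theorem norm_sq_eq_two_integral_inner {H : Type*} [NormedAddCommGroup H] [InnerProductSpace ℝ H]
    [CompleteSpace H] {T : ℝ} (hT : 0 < T) {θ θ' : ℝ → H} (hc : ContinuousOn θ (Ico 0 T))
    (hθ : MemL2Time T θ) (hθ' : MemL2Time T θ') (h : HasWeakTimeDeriv T θ θ') (h0 : θ 0 = 0)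
    {t : ℝ} (ht : t ∈ Ico 0 T) :
    ‖θ t‖ ^ 2 = 2 * ∫ s in Ioo 0 t, inner ℝ (θ s) (θ' s) := by
  have hrep := eq_add_primitive hT hc hθ hθ' h
  simp only [h0, zero_add] at hrep
  have hi : Integrable θ' (volume.restrict (Ioo 0 t)) :=
    hθ'.integrable.mono_measure (Measure.restrict_mono (Ioo_subset_Ioo_right ht.2.le) le_rfl)
  -- As `θ 0 = 0`, `θ` is the primitive of `θ'`; by symmetry the two terms coincide, whence the
  -- factor 2.
  have key : (∫ s in Ioo 0 t, inner ℝ (∫ r in Iio s, θ' r ∂(volume.restrict (Ioo 0 t))) (θ' s))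
      + ∫ s in Ioo 0 t, inner ℝ (θ' s) (∫ r in Iio s, θ' r ∂(volume.restrict (Ioo 0 t)))
      = inner ℝ (∫ s in Ioo 0 t, θ' s) (∫ s in Ioo 0 t, θ' s) :=
    integral_bilin_primitive (innerSL ℝ) (volume.restrict (Ioo 0 t)) hi hi
  have e : ∀ s ∈ Ioo 0 t, ∫ r in Iio s, θ' r ∂(volume.restrict (Ioo 0 t)) = θ s := by
    intro s hs
    rw [restrict_Ioo_restrict_Iio hs.2.le, hrep s ⟨hs.1.le, hs.2.trans ht.2⟩]
  have e1 : ∫ s in Ioo 0 t, inner ℝ (∫ r in Iio s, θ' r ∂(volume.restrict (Ioo 0 t))) (θ' s)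
      = ∫ s in Ioo 0 t, inner ℝ (θ s) (θ' s) :=
    setIntegral_congr_fun measurableSet_Ioo fun s hs => by simp only [e s hs]
  have e2 : ∫ s in Ioo 0 t, inner ℝ (θ' s) (∫ r in Iio s, θ' r ∂(volume.restrict (Ioo 0 t)))
      = ∫ s in Ioo 0 t, inner ℝ (θ s) (θ' s) :=
    setIntegral_congr_fun measurableSet_Ioo fun s hs => by
      simp only [e s hs]; rw [real_inner_comm]
  rw [e1, e2, ← hrep t ht, real_inner_self_eq_norm_sq] at key
  linarith

theorem integrable_inner_of_memLp {α H : Type*} [MeasurableSpace α] {μ : Measure α}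
    [NormedAddCommGroup H] [InnerProductSpace ℝ H] {f g : α → H} (hf : MemLp f 2 μ)
    (hg : MemLp g 2 μ) : Integrable (fun s => inner ℝ (f s) (g s)) μ :=
  memLp_one_iff_integrable.1 <| MemLp.of_bilin (fun x y => inner ℝ x y) 1 hf hg
    (hf.1.inner hg.1) (.of_forall fun x => by simpa using nnnorm_inner_le_nnnorm (𝕜 := ℝ) (f x) (g x))

theorem HasWeakTimeDeriv.sub {F : Type*} [NormedAddCommGroup F] [NormedSpace ℝ F] {T : ℝ}
    {θ₁ θ₂ θ₁' θ₂' : ℝ → F} (h₁ : HasWeakTimeDeriv T θ₁ θ₁') (h₂ : HasWeakTimeDeriv T θ₂ θ₂')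
    (m₁ : MemL2Time T θ₁) (m₂ : MemL2Time T θ₂) (m₁' : MemL2Time T θ₁') (m₂' : MemL2Time T θ₂') :
    HasWeakTimeDeriv T (fun t => θ₁ t - θ₂ t) (fun t => θ₁' t - θ₂' t) := by
  intro φ hφ hφc hφs
  have hsm : ∀ p : ℝ → ℝ, Continuous p → HasCompactSupport p → ∀ w : ℝ → F, MemL2Time T w →
      Integrable (fun t => p t • w t) (volume.restrict (Ioo 0 T)) := by
    intro p hp hpc w hw
    obtain ⟨C, hC⟩ := hp.bounded_above_of_compact_support hpc
    exact hw.integrable.bdd_smul C hp.aestronglyMeasurable (.of_forall hC)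
  have hdc : Continuous (deriv φ) := hφ.continuous_deriv (by simp)
  simp only [smul_sub]
  rw [integral_sub (hsm _ hdc hφc.deriv _ m₁) (hsm _ hdc hφc.deriv _ m₂),
    integral_sub (hsm _ hφ.continuous hφc _ m₁') (hsm _ hφ.continuous hφc _ m₂'),
    h₁ φ hφ hφc hφs, h₂ φ hφ hφc hφs]
  abel

theorem timeDeriv_spec {F : Type*} [NormedAddCommGroup F] [NormedSpace ℝ F] {T : ℝ} {θ : ℝ → F}
    (h : MemW12Time T θ) : MemL2Time T (timeDeriv T θ) ∧ HasWeakTimeDeriv T θ (timeDeriv T θ) := by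
  rw [timeDeriv, dif_pos h]
  exact h.2.choose_spec

/-! ## Weak derivatives on the whole space -/

theorem memLp_of_contDiff {n : ℕ} {φ : Euc n → ℝ} (hφ : ContDiff ℝ ∞ φ)
    (hc : HasCompactSupport φ) (μ : Measure (Euc n)) [IsFiniteMeasureOnCompacts μ] :
    MemLp φ 2 μ :=
  hφ.continuous.memLp_of_hasCompactSupport hc

theorem contDiff_partialDeriv {n : ℕ} (i : Fin n) {φ : Euc n → ℝ} (hφ : ContDiff ℝ ∞ φ) :
    ContDiff ℝ ∞ (partialDeriv i φ) :=
  (hφ.fderiv_right (m := ∞) (by simp)).clm_apply contDiff_const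

theorem hasCompactSupport_partialDeriv {n : ℕ} (i : Fin n) {φ : Euc n → ℝ}
    (hc : HasCompactSupport φ) : HasCompactSupport (partialDeriv i φ) :=
  hc.fderiv_apply (𝕜 := ℝ) _

theorem partialDeriv_mul {n : ℕ} (i : Fin n) {φ ψ : Euc n → ℝ} (hφ : ContDiff ℝ ∞ φ)
    (hψ : ContDiff ℝ ∞ ψ) (x : Euc n) :
    partialDeriv i (fun x => φ x * ψ x) x
      = φ x * partialDeriv i ψ x + ψ x * partialDeriv i φ x := by
  unfold partialDeriv
  rw [fderiv_fun_mul (hφ.differentiable (by simp)).differentiableAt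
    (hψ.differentiable (by simp)).differentiableAt]
  simp

/-- An element of `L²` that pairs with test functions as a bounded functional is bounded. -/
theorem norm_le_of_forall_inner_le {n : ℕ} (z : Lp ℝ 2 (volume : Measure (Euc n))) {C : ℝ}
    (hC : 0 ≤ C) (h : ∀ (φ : Euc n → ℝ) (hφ : ContDiff ℝ ∞ φ) (hc : HasCompactSupport φ),
      inner ℝ ((memLp_of_contDiff hφ hc volume).toLp φ) z
        ≤ C * ‖(memLp_of_contDiff hφ hc volume).toLp φ‖) :
    ‖z‖ ≤ C := by
  let K : Submodule ℝ (Lp ℝ 2 (volume : Measure (Euc n))) :=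
    { carrier := {f | ∃ (φ : Euc n → ℝ) (hφ : ContDiff ℝ ∞ φ) (hc : HasCompactSupport φ),
        f = (memLp_of_contDiff hφ hc volume).toLp φ}
      add_mem' := by
        rintro _ _ ⟨φ, hφ, hc, rfl⟩ ⟨ψ, hψ, hc', rfl⟩
        exact ⟨φ + ψ, hφ.add hψ, hc.add hc', rfl⟩
      zero_mem' := ⟨0, contDiff_const, HasCompactSupport.zero, rfl⟩
      smul_mem' := by
        rintro c _ ⟨φ, hφ, hc, rfl⟩
        exact ⟨c • φ, contDiff_const.smul hφ, hc.smul_left, rfl⟩ }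
  -- Test functions are dense: whatever is orthogonal to all of them is zero by the fundamental
  -- lemma of the calculus of variations.
  have hK : K.topologicalClosure = ⊤ := by
    rw [Submodule.topologicalClosure_eq_top_iff, Submodule.eq_bot_iff]
    intro f hf
    have hf' := (Submodule.mem_orthogonal K f).1 hf
    have : ∀ᵐ x, f x = 0 := by
      refine ae_eq_zero_of_integral_contDiff_smul_eq_zero
        ((Lp.memLp f).locallyIntegrable (by norm_num)) fun φ hφ hc => ?_
      have h0 := hf' _ ⟨φ, hφ, hc, rfl⟩
      rw [L2.inner_def] at h0
      rw [← h0]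
      refine integral_congr_ae ?_
      filter_upwards [(memLp_of_contDiff hφ hc volume).coeFn_toLp] with x hx
      rw [hx]; simp [mul_comm]
    exact (Lp.eq_zero_iff_ae_eq_zero).2 this
  have hall : ∀ y : Lp ℝ 2 (volume : Measure (Euc n)), inner ℝ y z ≤ C * ‖y‖ := by
    intro y
    have hy : y ∈ closure (K : Set _) := by
      rw [← Submodule.topologicalClosure_coe, hK]; trivial
    have hcl : IsClosed {y : Lp ℝ 2 (volume : Measure (Euc n)) | inner ℝ y z ≤ C * ‖y‖} :=
      isClosed_le (by fun_prop) (by fun_prop)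
    refine closure_minimal ?_ hcl hy
    rintro _ ⟨φ, hφ, hc, rfl⟩
    exact h φ hφ hc
  have hz := hall z
  rw [real_inner_self_eq_norm_sq] at hz
  rcases (norm_nonneg z).eq_or_lt with h0 | h0
  · exact h0 ▸ hC
  · nlinarith

/-- Translation by `h • e` on `L²`. -/
def translate {n : ℕ} (e : Euc n) (h : ℝ) :
    Lp ℝ 2 (volume : Measure (Euc n)) →ₗᵢ[ℝ] Lp ℝ 2 (volume : Measure (Euc n)) :=
  Lp.compMeasurePreservingₗᵢ ℝ (fun x => x + h • e) (measurePreserving_add_right volume (h • e))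

theorem translate_ae {n : ℕ} (e : Euc n) (h : ℝ) (u : Lp ℝ 2 (volume : Measure (Euc n))) :
    translate e h u =ᵐ[volume] fun x => u (x + h • e) :=
  Lp.coeFn_compMeasurePreserving u (measurePreserving_add_right volume (h • e))

theorem translate_zero {n : ℕ} (e : Euc n) (u : Lp ℝ 2 (volume : Measure (Euc n))) :
    translate e 0 u = u := by
  apply Lp.ext
  filter_upwards [translate_ae e 0 u] with x hx
  simpa using hx

theorem continuous_translate {n : ℕ} (e : Euc n) (u : Lp ℝ 2 (volume : Measure (Euc n))) :
    Continuous fun h => translate e h u := by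
  let g : C(ℝ, C(Euc n, Euc n)) :=
    (ContinuousMap.mk (fun a : ℝ × Euc n => a.2 + a.1 • e) (by fun_prop)).curry
  exact (continuous_const (y := u)).compMeasurePreservingLp g.continuous
    (fun h => measurePreserving_add_right volume (h • e)) (by norm_num)

theorem inner_toLp_translate {n : ℕ} (e : Euc n) (h : ℝ) (u : Lp ℝ 2 (volume : Measure (Euc n)))
    {φ : Euc n → ℝ} (hφ : MemLp φ 2 volume) :
    inner ℝ (hφ.toLp φ) (translate e h u) = ∫ x, u x * φ (x - h • e) := by
  rw [L2.inner_def, ← integral_add_right_eq_self (fun x => u x * φ (x - h • e)) (h • e)]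
  refine integral_congr_ae ?_
  filter_upwards [hφ.coeFn_toLp, translate_ae e h u] with x hx hx'
  rw [hx, hx']
  simp

/-- The pairing is the convolution of `u` with the reflected test function, evaluated at `h • e`.
The derivative therefore falls on the smooth factor, and the weak derivative moves it to `v`. -/
theorem hasDerivAt_inner_translate {n : ℕ} (i : Fin n)
    {u v : Lp ℝ 2 (volume : Measure (Euc n))}
    (huv : ∀ φ : Euc n → ℝ, ContDiff ℝ ∞ φ → HasCompactSupport φ →
      ∫ x, u x * partialDeriv i φ x = - ∫ x, v x * φ x)
    {φ : Euc n → ℝ} (hφ : ContDiff ℝ ∞ φ) (hc : HasCompactSupport φ) (h : ℝ) :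
    HasDerivAt (fun h => inner ℝ ((memLp_of_contDiff hφ hc volume).toLp φ)
        (translate (EuclideanSpace.single i 1) h u))
      (inner ℝ ((memLp_of_contDiff hφ hc volume).toLp φ)
        (translate (EuclideanSpace.single i 1) h v)) h := by
  simp only [inner_toLp_translate]
  set e : Euc n := EuclideanSpace.single i 1 with he
  set ψ : Euc n → ℝ := fun y => φ (-y) with hψ
  have hψd : ContDiff ℝ ∞ ψ := hφ.comp contDiff_neg
  have hψc : HasCompactSupport ψ := hc.comp_homeomorph (Homeomorph.neg _)
  have hui : LocallyIntegrable u volume := (Lp.memLp u).locallyIntegrable (by norm_num)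
  have h1 := hψc.hasFDerivAt_convolution_right (ContinuousLinearMap.mul ℝ ℝ) hui
    (hψd.of_le (by simp)) (h • e)
  have h2 : HasDerivAt (fun t : ℝ => t • e) e h := by
    simpa using (hasDerivAt_id h).smul_const e
  have h3 := h1.comp_hasDerivAt h h2
  rw [convolution_precompR_apply _ hui (hψc.fderiv (𝕜 := ℝ))
    (hψd.continuous_fderiv (by simp))] at h3
  convert! h3 using 1
  · ext t
    simp [convolution_def, hψ]
  · set χ : Euc n → ℝ := fun x => φ (x - h • e) with hχ
    have hχd : ContDiff ℝ ∞ χ := hφ.comp (contDiff_id.sub contDiff_const)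
    have hχc : HasCompactSupport χ := hc.comp_homeomorph (Homeomorph.subRight (h • e))
    rw [← neg_eq_iff_eq_neg.2 (huv χ hχd hχc), convolution_def, ← integral_neg]
    refine integral_congr_ae (.of_forall fun x => ?_)
    have e1 : fderiv ℝ χ x = fderiv ℝ φ (x - h • e) := fderiv_comp_sub ..
    have e2 : fderiv ℝ ψ (h • e - x) = - fderiv ℝ φ (x - h • e) := by
      have h4 := ((hφ.differentiable (by simp)).differentiableAt (x := -(h • e - x))).hasFDerivAt.comp
        (h • e - x) (hasFDerivAt_id (h • e - x)).neg
      refine h4.fderiv.trans ?_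
      ext; simp
    simp [partialDeriv, e1, e2, ← he]

/-- A weak derivative is the strong `L²` limit of difference quotients. Against each test function
the mean value inequality bounds the remainder by `|h| ε` times its norm, with `ε` controlling
`translate e s v - v` for small `s`. The bound is uniform in the test function, so duality turns it
into a norm bound. -/
theorem hasDerivAt_translate {n : ℕ} (i : Fin n)
    {u v : Lp ℝ 2 (volume : Measure (Euc n))}
    (huv : ∀ φ : Euc n → ℝ, ContDiff ℝ ∞ φ → HasCompactSupport φ →
      ∫ x, u x * partialDeriv i φ x = - ∫ x, v x * φ x) :
    HasDerivAt (fun h => translate (EuclideanSpace.single i 1) h u) v 0 := by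
  set e : Euc n := EuclideanSpace.single i 1 with he
  rw [hasDerivAt_iff_isLittleO, Asymptotics.isLittleO_iff]
  intro ε hε
  have hcont : Tendsto (fun h => translate e h v) (𝓝 0) (𝓝 v) := by
    simpa [translate_zero] using (continuous_translate e v).tendsto 0
  obtain ⟨δ, hδ, hball⟩ := Metric.tendsto_nhds_nhds.1 hcont ε hε
  filter_upwards [Metric.ball_mem_nhds (0 : ℝ) hδ] with h hh
  rw [translate_zero, sub_zero]
  refine norm_le_of_forall_inner_le _ (by positivity) fun φ hφ hc => ?_
  set p := (memLp_of_contDiff hφ hc volume).toLp φ with hp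
  have hd : ∀ s, HasDerivAt (fun s => inner ℝ p (translate e s u) - s * inner ℝ p v)
      (inner ℝ p (translate e s v) - inner ℝ p v) s := fun s => by
    have := (hasDerivAt_inner_translate i huv hφ hc s).sub
      ((hasDerivAt_id s).mul_const (inner ℝ p v))
    simpa using! this
  have hb := (convex_ball (0 : ℝ) δ).norm_image_sub_le_of_norm_hasDerivWithin_le
    (C := ‖p‖ * ε) (fun s _ => (hd s).hasDerivWithinAt) (fun s hs => by
      rw [← inner_sub_right]
      refine (norm_inner_le_norm _ _).trans ?_
      gcongr
      rw [← dist_eq_norm]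
      exact (hball hs).le) (Metric.mem_ball_self hδ) hh
  simp only [translate_zero, sub_zero, zero_mul] at hb
  have : inner ℝ p (translate e h u - u - h • v)
      = inner ℝ p (translate e h u) - h * inner ℝ p v - inner ℝ p u := by
    rw [inner_sub_right, inner_sub_right, inner_smul_right]; ring
  rw [this]
  refine (le_abs_self _).trans (hb.trans (le_of_eq ?_))
  ring

/-- Integration by parts on the whole space. -/
theorem inner_weakPartial_whole {n : ℕ} (i : Fin n)
    {u v w w' : Lp ℝ 2 (volume : Measure (Euc n))}
    (huv : ∀ φ : Euc n → ℝ, ContDiff ℝ ∞ φ → HasCompactSupport φ →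
      ∫ x, u x * partialDeriv i φ x = - ∫ x, v x * φ x)
    (hw : ∀ φ : Euc n → ℝ, ContDiff ℝ ∞ φ → HasCompactSupport φ →
      ∫ x, w x * partialDeriv i φ x = - ∫ x, w' x * φ x) :
    inner ℝ u w' = - inner ℝ v w := by
  -- Translations are isometries, so the pairing of the translates is constant in `h`; the product
  -- rule at `h = 0` is the claim.
  have h1 := (hasDerivAt_translate i huv).inner ℝ (hasDerivAt_translate i hw)
  simp only [LinearIsometry.inner_map_map, translate_zero] at h1
  have := h1.unique (hasDerivAt_const 0 _)
  linarith

theorem inner_weakPartial_plane (i : Fin 2) {u v w w' : L2 plane}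
    (hu : HasWeakPartial plane i u v) (hw : HasWeakPartial plane i w w') :
    inner ℝ u w' = - inner ℝ v w := by
  -- The measure of `L2 plane` is `volume.restrict univ`, and the type depends on it; a variable
  -- measure allows substitution.
  have key : ∀ (μ : Measure (Euc 2)), μ = volume → ∀ u v w w' : Lp ℝ 2 μ,
      (∀ φ : Euc 2 → ℝ, ContDiff ℝ ∞ φ → HasCompactSupport φ →
        ∫ x, u x * partialDeriv i φ x ∂μ = - ∫ x, v x * φ x ∂μ) →
      (∀ φ : Euc 2 → ℝ, ContDiff ℝ ∞ φ → HasCompactSupport φ →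
        ∫ x, w x * partialDeriv i φ x ∂μ = - ∫ x, w' x * φ x ∂μ) →
      inner ℝ u w' = - inner ℝ v w := by
    rintro μ rfl u v w w' h1 h2
    exact inner_weakPartial_whole i h1 h2
  exact key _ (by simp [plane]) u v w w' (fun φ h1 h2 => hu φ h1 h2 (subset_univ _))
    (fun φ h1 h2 => hw φ h1 h2 (subset_univ _))

/-! ## Integration over the half spaces -/

/-- The point of `ℝ³` with vertical coordinate `t` and horizontal coordinates `y`. -/
def verticalPt (t : ℝ) (y : Euc 2) : Euc 3 := !₂[y 0, y 1, t]

theorem measurePreserving_verticalPt :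
    MeasurePreserving (fun z : ℝ × Euc 2 => verticalPt z.1 z.2) (volume.prod volume) volume := by
  have h1 := (MeasurePreserving.id (volume : Measure ℝ)).prod
    (PiLp.volume_preserving_ofLp (Fin 2))
  have h2 := (volume_preserving_piFinSuccAbove (fun _ : Fin 3 => ℝ) 2).symm
  have h3 := PiLp.volume_preserving_toLp (Fin 3)
  convert! h3.comp (h2.comp h1) using 1
  ext z i
  fin_cases i <;> simp [verticalPt, MeasurableEquiv.piFinSuccAbove, Fin.insertNthEquiv]
  · exact (Fin.insertNth_apply_succAbove (α := fun _ => ℝ) 2 z.1 z.2.ofLp 0).symm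
  · exact (Fin.insertNth_apply_succAbove (α := fun _ => ℝ) 2 z.1 z.2.ofLp 1).symm

theorem continuous_verticalPt : Continuous fun z : ℝ × Euc 2 => verticalPt z.1 z.2 := by
  unfold verticalPt
  refine (PiLp.continuous_toLp 2 _).comp (continuous_pi fun i => ?_)
  fin_cases i <;> simp <;> fun_prop

/-- Fubini with the vertical integral inside, so that in a half space the fundamental theorem of
calculus applies on each vertical line. -/
theorem setIntegral_vertical {f : Euc 3 → ℝ} (hf : Continuous f) (hc : HasCompactSupport f)
    {I : Set ℝ} (hI : MeasurableSet I) :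
    ∫ x in {x : Euc 3 | x 2 ∈ I}, f x = ∫ y, ∫ t in I, f (verticalPt t y) := by
  have hm : MeasurableSet {x : Euc 3 | x 2 ∈ I} :=
    (by fun_prop : Measurable fun x : Euc 3 => x 2) hI
  have hfi : Integrable f volume := hf.integrable_of_hasCompactSupport hc
  rw [← integral_indicator hm, ← measurePreserving_verticalPt.map_eq,
    integral_map continuous_verticalPt.measurable.aemeasurable
      (by rw [measurePreserving_verticalPt.map_eq]; exact (hfi.indicator hm).aestronglyMeasurable)]
  have hi : Integrable (fun z : ℝ × Euc 2 =>
      indicator {x : Euc 3 | x 2 ∈ I} f (verticalPt z.1 z.2)) (volume.prod volume) :=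
    measurePreserving_verticalPt.integrable_comp_of_integrable (hfi.indicator hm)
  rw [integral_prod_symm _ hi]
  refine integral_congr_ae (.of_forall fun y => ?_)
  simp only
  rw [← integral_indicator hI]
  refine integral_congr_ae (.of_forall fun t => ?_)
  by_cases ht : t ∈ I <;> simp [ht, verticalPt]

theorem hasDerivAt_verticalPt (t : ℝ) (y : Euc 2) :
    HasDerivAt (fun t => verticalPt t y) (EuclideanSpace.single 2 1) t := by
  have : (fun t => verticalPt t y) = fun t => verticalPt 0 y + t • EuclideanSpace.single 2 1 := by
    ext t i; fin_cases i <;> simp [verticalPt]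
  rw [this]
  simpa using ((hasDerivAt_id t).smul_const (EuclideanSpace.single (2 : Fin 3) (1 : ℝ))).const_add
    (verticalPt 0 y)

theorem contDiff_verticalPt (y : Euc 2) : ContDiff ℝ ∞ fun t => verticalPt t y := by
  have : (fun t => verticalPt t y) = fun t => verticalPt 0 y + t • EuclideanSpace.single 2 1 := by
    ext t i; fin_cases i <;> simp [verticalPt]
  rw [this]
  fun_prop

theorem hasCompactSupport_comp_verticalPt_left {f : Euc 3 → ℝ} (hc : HasCompactSupport f)
    (y : Euc 2) : HasCompactSupport fun t => f (verticalPt t y) := by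
  have hl : Function.LeftInverse (fun x : Euc 3 => x 2) (fun t => verticalPt t y) := by
    intro t; simp [verticalPt]
  exact hc.comp_isClosedEmbedding (hl.isClosedEmbedding (by fun_prop)
    (contDiff_verticalPt y).continuous)

theorem deriv_comp_verticalPt {f : Euc 3 → ℝ} (hf : ContDiff ℝ ∞ f) (y : Euc 2) :
    deriv (fun t => f (verticalPt t y)) = fun t => partialDeriv 2 f (verticalPt t y) := by
  ext t
  exact ((hf.differentiable (by simp)).differentiableAt.hasFDerivAt.comp_hasDerivAt t
    (hasDerivAt_verticalPt t y)).deriv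

/-- The factor `-1`, like `1` for the lower half space, is the third component of the outward
normal; it becomes `σ` in Green's formula. -/
theorem integral_upperHalf_partialDeriv {f : Euc 3 → ℝ} (hf : ContDiff ℝ ∞ f)
    (hc : HasCompactSupport f) :
    ∫ x in upperHalf, partialDeriv 2 f x = -1 * ∫ y in plane, f (interfacePt y) := by
  have := setIntegral_vertical (contDiff_partialDeriv 2 hf).continuous
    (hasCompactSupport_partialDeriv 2 hc) (measurableSet_Ioi (a := (0 : ℝ)))
  rw [upperHalf, plane, setIntegral_univ, ← integral_const_mul]
  refine this.trans (integral_congr_ae (.of_forall fun y => ?_))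
  have h := (hasCompactSupport_comp_verticalPt_left hc y).integral_Ioi_deriv_eq
    ((hf.comp (contDiff_verticalPt y)).of_le (by simp)) 0
  rw [Function.comp_def, deriv_comp_verticalPt hf y] at h
  simp only [h]
  simp [interfacePt, verticalPt]

theorem integral_lowerHalf_partialDeriv {f : Euc 3 → ℝ} (hf : ContDiff ℝ ∞ f)
    (hc : HasCompactSupport f) :
    ∫ x in lowerHalf, partialDeriv 2 f x = 1 * ∫ y in plane, f (interfacePt y) := by
  have := setIntegral_vertical (contDiff_partialDeriv 2 hf).continuous
    (hasCompactSupport_partialDeriv 2 hc) (measurableSet_Iio (a := (0 : ℝ)))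
  rw [lowerHalf, plane, setIntegral_univ, one_mul]
  refine this.trans (integral_congr_ae (.of_forall fun y => ?_))
  have h := (hasCompactSupport_comp_verticalPt_left hc y).integral_Iic_deriv_eq
    ((hf.comp (contDiff_verticalPt y)).of_le (by simp)) 0
  rw [Function.comp_def, deriv_comp_verticalPt hf y, integral_Iic_eq_integral_Iio] at h
  simp only [h]
  simp [interfacePt, verticalPt]

/-! ## Traces and Green's formula -/

theorem contDiff_interfacePt : ContDiff ℝ ∞ interfacePt := by
  unfold interfacePt
  refine (PiLp.contDiff_toLp (𝕜 := ℝ) (p := 2)).comp (contDiff_pi.2 fun i => ?_)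
  fin_cases i <;> simp <;> fun_prop

theorem hasCompactSupport_comp_interfacePt {f : Euc 3 → ℝ} (hc : HasCompactSupport f) :
    HasCompactSupport fun y => f (interfacePt y) := by
  have hinv : Continuous fun x : Euc 3 => (!₂[x 0, x 1] : Euc 2) := by
    refine (PiLp.continuous_toLp 2 _).comp (continuous_pi fun i => ?_)
    fin_cases i <;> simp <;> fun_prop
  have hl : Function.LeftInverse (fun x : Euc 3 => (!₂[x 0, x 1] : Euc 2)) interfacePt := by
    intro y
    ext i; fin_cases i <;> simp [interfacePt]
  exact hc.comp_isClosedEmbedding (hl.isClosedEmbedding hinv contDiff_interfacePt.continuous)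

/-- The class in `L²(Ω)` of a test function on `ℝⁿ`. -/
def testLp {n : ℕ} (Ω : Set (Euc n)) {φ : Euc n → ℝ} (hφ : ContDiff ℝ ∞ φ)
    (hc : HasCompactSupport φ) : L2 Ω :=
  (memLp_of_contDiff hφ hc (volume.restrict Ω)).toLp φ

theorem testLp_ae {n : ℕ} (Ω : Set (Euc n)) {φ : Euc n → ℝ} (hφ : ContDiff ℝ ∞ φ)
    (hc : HasCompactSupport φ) : testLp Ω hφ hc =ᵐ[volume.restrict Ω] φ :=
  MemLp.coeFn_toLp _

theorem tendsto_testLp {n : ℕ} {Ω : Set (Euc n)} {φ : ℕ → Euc n → ℝ}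
    (hφ : ∀ m, ContDiff ℝ ∞ (φ m)) (hc : ∀ m, HasCompactSupport (φ m)) {u : L2 Ω}
    (h : Tendsto (fun m => eLpNorm (fun x => φ m x - u x) 2 (volume.restrict Ω)) atTop (𝓝 0)) :
    Tendsto (fun m => testLp Ω (hφ m) (hc m)) atTop (𝓝 u) := by
  rw [Lp.tendsto_Lp_iff_tendsto_eLpNorm']
  refine h.congr fun m => eLpNorm_congr_ae ?_
  filter_upwards [testLp_ae Ω (hφ m) (hc m)] with x hx
  simp [hx]

theorem inner_testLp {n : ℕ} {Ω : Set (Euc n)} {φ : Euc n → ℝ} (hφ : ContDiff ℝ ∞ φ)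
    (hc : HasCompactSupport φ) (w : L2 Ω) :
    inner ℝ (testLp Ω hφ hc) w = ∫ x in Ω, w x * φ x := by
  rw [L2.inner_def]
  refine integral_congr_ae ?_
  filter_upwards [testLp_ae Ω hφ hc] with x hx
  rw [hx]; simp

theorem inner_testLp_testLp {n : ℕ} {Ω : Set (Euc n)} {φ ψ : Euc n → ℝ} (hφ : ContDiff ℝ ∞ φ)
    (hc : HasCompactSupport φ) (hψ : ContDiff ℝ ∞ ψ) (hc' : HasCompactSupport ψ) :
    inner ℝ (testLp Ω hφ hc) (testLp Ω hψ hc') = ∫ x in Ω, φ x * ψ x := by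
  rw [inner_testLp]
  refine integral_congr_ae ?_
  filter_upwards [testLp_ae Ω hψ hc'] with x hx
  rw [hx, mul_comm]

/-- `u` has the gradient `d` and the trace `g`, as limits of test functions on `ℝ³`. -/
def HasTraceGrad (Ω : Set (Euc 3)) (u : L2 Ω) (d : Fin 3 → L2 Ω) (g : L2 plane) : Prop :=
  ∃ (φ : ℕ → Euc 3 → ℝ) (hφ : ∀ m, ContDiff ℝ ∞ (φ m)) (hc : ∀ m, HasCompactSupport (φ m)),
    Tendsto (fun m => testLp Ω (hφ m) (hc m)) atTop (𝓝 u) ∧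
    (∀ i, Tendsto (fun m => testLp Ω (contDiff_partialDeriv i (hφ m))
      (hasCompactSupport_partialDeriv i (hc m))) atTop (𝓝 (d i))) ∧
    Tendsto (fun m => testLp plane ((hφ m).comp contDiff_interfacePt)
      (hasCompactSupport_comp_interfacePt (hc m))) atTop (𝓝 g)

theorem HasTrace.hasTraceGrad {Ω : Set (Euc 3)} {u : L2 Ω} {g : L2 plane} (h : HasTrace Ω u g) :
    HasTraceGrad Ω u (fun i => weakPartial Ω i u) g := by
  obtain ⟨-, φ, hφ, h1, h2, h3⟩ := h
  exact ⟨φ, fun m => (hφ m).1, fun m => (hφ m).2, tendsto_testLp _ _ h1,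
    fun i => tendsto_testLp _ _ (h2 i), tendsto_testLp _ _ h3⟩

theorem testLp_sub {n : ℕ} {Ω : Set (Euc n)} {φ ψ χ : Euc n → ℝ} (hφ : ContDiff ℝ ∞ φ)
    (hc : HasCompactSupport φ) (hψ : ContDiff ℝ ∞ ψ) (hc' : HasCompactSupport ψ)
    (hχ : ContDiff ℝ ∞ χ) (hc'' : HasCompactSupport χ) (h : ∀ x, χ x = φ x - ψ x) :
    testLp Ω hχ hc'' = testLp Ω hφ hc - testLp Ω hψ hc' := by
  apply Lp.ext
  filter_upwards [testLp_ae Ω hφ hc, testLp_ae Ω hψ hc', testLp_ae Ω hχ hc'',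
    Lp.coeFn_sub (testLp Ω hφ hc) (testLp Ω hψ hc')] with x h1 h2 h3 h4
  rw [h4, Pi.sub_apply, h1, h2, h3, h]

/-- Since `weakPartial` is defined by choice, its linearity would require uniqueness of weak
derivatives. Carrying the gradient as data avoids this when solutions are subtracted. -/
theorem HasTraceGrad.sub {Ω : Set (Euc 3)} {u v : L2 Ω} {d e : Fin 3 → L2 Ω} {g h : L2 plane}
    (hu : HasTraceGrad Ω u d g) (hv : HasTraceGrad Ω v e h) :
    HasTraceGrad Ω (u - v) (fun i => d i - e i) (g - h) := by
  obtain ⟨φ, hφ, hc, h1, h2, h3⟩ := hu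
  obtain ⟨ψ, hψ, hc', k1, k2, k3⟩ := hv
  refine ⟨fun m x => φ m x - ψ m x, fun m => (hφ m).sub (hψ m), fun m => (hc m).sub (hc' m),
    (h1.sub k1).congr fun m => ?_, fun i => ((h2 i).sub (k2 i)).congr fun m => ?_,
    (h3.sub k3).congr fun m => ?_⟩
  · exact (testLp_sub _ _ _ _ _ _ fun x => rfl).symm
  · refine (testLp_sub _ _ _ _ _ _ fun x => ?_).symm
    unfold partialDeriv
    rw [fderiv_fun_sub ((hφ m).differentiable (by simp)).differentiableAt
      ((hψ m).differentiable (by simp)).differentiableAt]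
    simp
  · exact (testLp_sub _ _ _ _ _ _ fun x => rfl).symm

theorem HasWeakPartial.sub {n : ℕ} {Ω : Set (Euc n)} {i : Fin n} {u v u' v' : L2 Ω}
    (hu : HasWeakPartial Ω i u u') (hv : HasWeakPartial Ω i v v') :
    HasWeakPartial Ω i (u - v) (u' - v') := by
  intro φ hφ hc hs
  have h1 := hu φ hφ hc hs
  have h2 := hv φ hφ hc hs
  rw [← inner_testLp hφ hc, ← inner_testLp (contDiff_partialDeriv i hφ)
    (hasCompactSupport_partialDeriv i hc)] at h1 h2 ⊢
  rw [inner_sub_right, inner_sub_right, h1, h2]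
  ring

theorem weakPartial_spec {n : ℕ} {Ω : Set (Euc n)} {u : L2 Ω} (hu : MemW12 Ω u) (i : Fin n) :
    HasWeakPartial Ω i u (weakPartial Ω i u) := by
  rw [weakPartial, dif_pos (hu i)]
  exact (hu i).choose_spec

/-- Integration by parts in the vertical direction, with the boundary term. -/
theorem HasTraceGrad.inner_vertical {Ω : Set (Euc 3)} {σ : ℝ}
    (hΩ : ∀ f : Euc 3 → ℝ, ContDiff ℝ ∞ f → HasCompactSupport f →
      ∫ x in Ω, partialDeriv 2 f x = σ * ∫ y in plane, f (interfacePt y))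
    {u w : L2 Ω} {d e : Fin 3 → L2 Ω} {g h : L2 plane}
    (hu : HasTraceGrad Ω u d g) (hw : HasTraceGrad Ω w e h) :
    inner ℝ u (e 2) + inner ℝ w (d 2) = σ * inner ℝ g h := by
  obtain ⟨φ, hφ, hc, h1, h2, h3⟩ := hu
  obtain ⟨ψ, hψ, hc', k1, k2, k3⟩ := hw
  -- For test functions this is the boundary formula for the product `φ m * ψ m`; every pairing
  -- passes to the limit.
  refine tendsto_nhds_unique ((h1.inner (k2 2)).add (k1.inner (h2 2)))
    (((h3.inner k3).const_mul σ).congr fun m => ?_)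
  simp only [inner_testLp_testLp]
  rw [← integral_add]
  · have := hΩ (fun x => φ m x * ψ m x) ((hφ m).mul (hψ m)) ((hc m).mul_right)
    simp only [partialDeriv_mul 2 (hφ m) (hψ m)] at this
    exact this.symm
  · exact ((((hφ m).mul (contDiff_partialDeriv 2 (hψ m))).continuous).integrable_of_hasCompactSupport
      ((hc m).mul_right)).integrableOn
  · exact ((((hψ m).mul (contDiff_partialDeriv 2 (hφ m))).continuous).integrable_of_hasCompactSupport
      ((hc' m).mul_right)).integrableOn

/-- A smooth cut-off function of the vertical coordinate. -/
def cutoff (s : ℝ) (k : ℕ) (x : Euc 3) : ℝ := Real.smoothTransition (k * (s * x 2) - 1)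

theorem contDiff_cutoff (s : ℝ) (k : ℕ) : ContDiff ℝ ∞ (cutoff s k) :=
  Real.smoothTransition.contDiff.comp (by fun_prop)

theorem tsupport_cutoff_subset (s : ℝ) (k : ℕ) :
    tsupport (cutoff s k) ⊆ {x : Euc 3 | 0 < s * x 2} := by
  have : tsupport (cutoff s k) ⊆ {x : Euc 3 | 1 ≤ k * (s * x 2)} := by
    refine closure_minimal (fun x hx => ?_) (isClosed_le (by fun_prop) (by fun_prop))
    by_contra h
    simp only [mem_ofPred_eq, not_le] at h
    exact hx (Real.smoothTransition.zero_of_nonpos (by linarith))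
  intro x hx
  have h1 : 1 ≤ k * (s * x 2) := this hx
  exact pos_of_mul_pos_right (one_pos.trans_le h1) (Nat.cast_nonneg k)

/-- The cut-off depends on `x 2` alone, so horizontal differentiation never produces a term growing
with `k`. -/
theorem partialDeriv_cutoff (s : ℝ) (k : ℕ) {i : Fin 3} (hi : i ≠ 2) (x : Euc 3) :
    partialDeriv i (cutoff s k) x = 0 := by
  have hd : DifferentiableAt ℝ (cutoff s k) x :=
    ((contDiff_cutoff s k).differentiable (by simp)).differentiableAt
  have h1 : HasDerivAt (fun t : ℝ => x + t • EuclideanSpace.single i (1 : ℝ))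
      (EuclideanSpace.single i 1) 0 := by
    simpa using ((hasDerivAt_id (0 : ℝ)).smul_const (EuclideanSpace.single i (1 : ℝ))).const_add x
  have h2 := HasFDerivAt.comp_hasDerivAt_of_eq (0 : ℝ) hd.hasFDerivAt h1 (by simp)
  have h3 : cutoff s k ∘ (fun t : ℝ => x + t • EuclideanSpace.single i (1 : ℝ))
      = fun _ => cutoff s k x := by
    ext t
    simp [cutoff, hi.symm]
  rw [h3] at h2
  exact h2.unique (hasDerivAt_const _ _)

theorem tendsto_cutoff {s : ℝ} {x : Euc 3} (hx : 0 < s * x 2) :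
    Tendsto (fun k => cutoff s k x) atTop (𝓝 1) := by
  refine tendsto_const_nhds.congr' ?_
  -- From this index on `k * (s * x 2) ≥ 2`, so the argument of the transition function is at least
  -- one.
  obtain ⟨N, hN⟩ := exists_nat_gt (2 / (s * x 2))
  filter_upwards [eventually_ge_atTop N] with k hk
  refine (Real.smoothTransition.one_of_one_le ?_).symm
  have h1 : (2 / (s * x 2)) < k := hN.trans_le (by exact_mod_cast hk)
  rw [div_lt_iff₀ hx] at h1
  linarith

theorem tendsto_setIntegral_cutoff {Ω : Set (Euc 3)} {s : ℝ} (hΩ : Ω = {x | 0 < s * x 2})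
    {f : Euc 3 → ℝ} (hf : Integrable f (volume.restrict Ω)) :
    Tendsto (fun k => ∫ x in Ω, f x * cutoff s k x) atTop (𝓝 (∫ x in Ω, f x)) := by
  have hm : MeasurableSet Ω := by
    rw [hΩ]; exact measurableSet_lt (by fun_prop) (by fun_prop)
  refine tendsto_integral_of_dominated_convergence (fun x => ‖f x‖)
    (fun k => hf.1.mul (contDiff_cutoff s k).continuous.aestronglyMeasurable) hf.norm
    (fun k => .of_forall fun x => ?_) ?_
  · rw [norm_mul]
    refine mul_le_of_le_one_right (norm_nonneg _) ?_
    rw [cutoff, Real.norm_of_nonneg (Real.smoothTransition.nonneg _)]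
    exact Real.smoothTransition.le_one _
  · rw [ae_restrict_iff' hm]
    refine .of_forall fun x hx => ?_
    rw [hΩ] at hx
    simpa using (tendsto_cutoff hx).const_mul (f x)

/-- Horizontal weak derivatives can be tested with functions that do not vanish at the boundary. -/
theorem HasWeakPartial.inner_testLp_horizontal {Ω : Set (Euc 3)} {s : ℝ}
    (hΩ : Ω = {x | 0 < s * x 2}) {i : Fin 3} (hi : i ≠ 2) {w w' : L2 Ω}
    (hw : HasWeakPartial Ω i w w') {φ : Euc 3 → ℝ} (hφ : ContDiff ℝ ∞ φ)
    (hc : HasCompactSupport φ) :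
    inner ℝ (testLp Ω hφ hc) w' = - inner ℝ (testLp Ω (contDiff_partialDeriv i hφ)
      (hasCompactSupport_partialDeriv i hc)) w := by
  rw [inner_testLp, inner_testLp]
  have hint : ∀ {ψ : Euc 3 → ℝ}, ContDiff ℝ ∞ ψ → HasCompactSupport ψ → ∀ v : L2 Ω,
      Integrable (fun x => v x * ψ x) (volume.restrict Ω) := fun h h' v =>
    (Lp.memLp v).integrable_mul (memLp_of_contDiff h h' _)
  have h1 := tendsto_setIntegral_cutoff hΩ (hint hφ hc w')
  have h2 := tendsto_setIntegral_cutoff hΩ (hint (contDiff_partialDeriv i hφ)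
    (hasCompactSupport_partialDeriv i hc) w)
  refine tendsto_nhds_unique h1 (h2.neg.congr fun k => ?_)
  -- The cut-off pushes the support into the open half space, making the product an admissible test
  -- function.
  have := hw (fun x => φ x * cutoff s k x) (hφ.mul (contDiff_cutoff s k)) hc.mul_right
    ((tsupport_mul_subset_right).trans (hΩ ▸ tsupport_cutoff_subset s k))
  simp only [partialDeriv_mul i hφ (contDiff_cutoff s k), partialDeriv_cutoff s k hi, mul_zero,
    zero_add] at this
  simp only [mul_assoc]
  rw [eq_comm, ← neg_eq_iff_eq_neg, ← this]
  simp only [mul_comm (cutoff s k _)]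

/-- The normal has no horizontal component, so there is no boundary term. Only `u` is approximated;
`w` needs no trace. -/
theorem HasTraceGrad.inner_horizontal {Ω : Set (Euc 3)} {s : ℝ}
    (hΩ : Ω = {x | 0 < s * x 2}) {i : Fin 3} (hi : i ≠ 2) {u w w' : L2 Ω} {d : Fin 3 → L2 Ω}
    {g : L2 plane} (hu : HasTraceGrad Ω u d g) (hw : HasWeakPartial Ω i w w') :
    inner ℝ u w' = - inner ℝ (d i) w := by
  obtain ⟨φ, hφ, hc, h1, h2, -⟩ := hu
  refine tendsto_nhds_unique (h1.inner tendsto_const_nhds)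
    ((((h2 i).inner tendsto_const_nhds).neg).congr fun m => ?_)
  exact (hw.inner_testLp_horizontal hΩ hi (hφ m) (hc m)).symm

/-- Green's formula `∫ u Δu = -∫ |∇u|² + σ ∫ γ[u] γ[∂₃u]` in a half space. -/
theorem green_halfSpace {Ω : Set (Euc 3)} {s σ : ℝ} (hΩ : Ω = {x | 0 < s * x 2})
    (hσ : ∀ f : Euc 3 → ℝ, ContDiff ℝ ∞ f → HasCompactSupport f →
      ∫ x in Ω, partialDeriv 2 f x = σ * ∫ y in plane, f (interfacePt y))
    {u : L2 Ω} {d e e' : Fin 3 → L2 Ω} {g h : L2 plane} (hu : HasTraceGrad Ω u d g)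
    (hd : ∀ i, HasWeakPartial Ω i (d i) (e i)) (h2 : HasTraceGrad Ω (d 2) e' h) (he : e' 2 = e 2) :
    inner ℝ u (∑ i, e i) = - ∑ i, ‖d i‖ ^ 2 + σ * inner ℝ g h := by
  -- The boundary term comes only from the vertical direction, where `d 2` is the second factor and
  -- `h` is its trace.
  have hv := hu.inner_vertical hσ h2
  have h0 := hu.inner_horizontal hΩ (i := 0) (by decide) (hd 0)
  have h1 := hu.inner_horizontal hΩ (i := 1) (by decide) (hd 1)
  rw [real_inner_self_eq_norm_sq] at hv h0 h1
  rw [Fin.sum_univ_three, Fin.sum_univ_three, inner_add_right, inner_add_right, h0, h1, ← he]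
  linarith

theorem upperHalf_eq : upperHalf = {x : Euc 3 | 0 < (1 : ℝ) * x 2} := by
  simp [upperHalf]

theorem lowerHalf_eq : lowerHalf = {x : Euc 3 | 0 < (-1 : ℝ) * x 2} := by
  simp [lowerHalf]

/-! ## The energy estimate -/

theorem inner_sub_laplacian_halfSpace_le {Ω : Set (Euc 3)} {s σ : ℝ} (hΩ : Ω = {x | 0 < s * x 2})
    (hσ : ∀ f : Euc 3 → ℝ, ContDiff ℝ ∞ f → HasCompactSupport f →
      ∫ x in Ω, partialDeriv 2 f x = σ * ∫ y in plane, f (interfacePt y))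
    {u v : L2 Ω} {g g' h h' : L2 plane} (hu : MemW22 Ω u) (hv : MemW22 Ω v)
    (hug : HasTrace Ω u g) (hvg : HasTrace Ω v g')
    (huh : HasTrace Ω (weakPartial Ω 2 u) h) (hvh : HasTrace Ω (weakPartial Ω 2 v) h') :
    inner ℝ (u - v) (laplacian Ω u - laplacian Ω v) ≤ σ * inner ℝ (g - g') (h - h') := by
  have key := green_halfSpace hΩ hσ (hug.hasTraceGrad.sub hvg.hasTraceGrad)
    (e := fun i => weakPartial Ω i (weakPartial Ω i u) - weakPartial Ω i (weakPartial Ω i v))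
    (fun i => (weakPartial_spec (hu.2 i) i).sub (weakPartial_spec (hv.2 i) i))
    (huh.hasTraceGrad.sub hvh.hasTraceGrad) rfl
  rw [laplacian, laplacian, ← Finset.sum_sub_distrib, key]
  have : 0 ≤ ∑ i, ‖weakPartial Ω i u - weakPartial Ω i v‖ ^ 2 :=
    Finset.sum_nonneg fun i _ => sq_nonneg _
  linarith

theorem inner_sub_laplacian_plane_nonpos {u v : L2 plane} (hu : MemW22 plane u)
    (hv : MemW22 plane v) : inner ℝ (u - v) (laplacian plane u - laplacian plane v) ≤ 0 := by
  rw [laplacian, laplacian, ← Finset.sum_sub_distrib, inner_sum]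
  refine Finset.sum_nonpos fun i _ => ?_
  rw [inner_weakPartial_plane i ((weakPartial_spec hu.1 i).sub (weakPartial_spec hv.1 i))
    ((weakPartial_spec (hu.2 i) i).sub (weakPartial_spec (hv.2 i) i)),
    real_inner_self_eq_norm_sq]
  exact neg_nonpos.2 (sq_nonneg _)

theorem InRegularityClass.norm_sub_sq {n : ℕ} {Ω : Set (Euc n)} {T : ℝ} (hT : 0 < T)
    {θ₁ θ₂ : ℝ → L2 Ω} (h₁ : InRegularityClass Ω T θ₁) (h₂ : InRegularityClass Ω T θ₂)
    (h0 : θ₁ 0 = θ₂ 0) {t : ℝ} (ht : t ∈ Ico 0 T) :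
    ‖θ₁ t - θ₂ t‖ ^ 2
      = 2 * ∫ s in Ioo 0 t, inner ℝ (θ₁ s - θ₂ s) (timeDeriv T θ₁ s - timeDeriv T θ₂ s) := by
  obtain ⟨m₁, d₁⟩ := timeDeriv_spec h₁.memW12Time
  obtain ⟨m₂, d₂⟩ := timeDeriv_spec h₂.memW12Time
  exact norm_sq_eq_two_integral_inner hT (h₁.continuousOn.sub h₂.continuousOn)
    (MemLp.sub h₁.memW12Time.1 h₂.memW12Time.1) (MemLp.sub m₁ m₂)
    (d₁.sub d₂ h₁.memW12Time.1 h₂.memW12Time.1 m₁ m₂) (sub_eq_zero.2 h0) ht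

theorem InRegularityClass.integrable_inner_sub {n : ℕ} {Ω : Set (Euc n)} {T : ℝ}
    {θ₁ θ₂ : ℝ → L2 Ω} (h₁ : InRegularityClass Ω T θ₁) (h₂ : InRegularityClass Ω T θ₂)
    {t : ℝ} (ht : t ≤ T) :
    IntegrableOn (fun s => inner ℝ (θ₁ s - θ₂ s) (timeDeriv T θ₁ s - timeDeriv T θ₂ s))
      (Ioo 0 t) :=
  (integrable_inner_of_memLp (μ := volume.restrict (Ioo 0 T))
    (MemLp.sub h₁.memW12Time.1 h₂.memW12Time.1)
    (MemLp.sub (timeDeriv_spec h₁.memW12Time).1 (timeDeriv_spec h₂.memW12Time).1)).mono_measure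
    (Measure.restrict_mono (Ioo_subset_Ioo_right ht) le_rfl)

/-- The bulk equations bring the weights `κA`, `κB` to the boundary terms. These cancel the fluxes
of the interface equation because both bulk traces equal the surface temperature; the weight `αS`
lets that equation be inserted directly. -/
theorem IsStrongSolution.energy_dissipation {κA κB κS αS T : ℝ} (hκA : 0 < κA) (hκB : 0 < κB)
    (hκS : 0 < κS) {θA₀ : L2 upperHalf} {θB₀ : L2 lowerHalf} {θS₀ : L2 plane}
    {θA₁ θA₂ : ℝ → L2 upperHalf} {θB₁ θB₂ : ℝ → L2 lowerHalf} {θS₁ θS₂ : ℝ → L2 plane}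
    (h₁ : IsStrongSolution κA κB κS αS T θA₀ θB₀ θS₀ θA₁ θB₁ θS₁)
    (h₂ : IsStrongSolution κA κB κS αS T θA₀ θB₀ θS₀ θA₂ θB₂ θS₂) :
    ∀ᵐ t ∂volume.restrict (Ioo 0 T),
      inner ℝ (θA₁ t - θA₂ t) (timeDeriv T θA₁ t - timeDeriv T θA₂ t)
      + inner ℝ (θB₁ t - θB₂ t) (timeDeriv T θB₁ t - timeDeriv T θB₂ t)
      + αS * inner ℝ (θS₁ t - θS₂ t) (timeDeriv T θS₁ t - timeDeriv T θS₂ t) ≤ 0 := by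
  filter_upwards [h₁.regA.memL2W22.1, h₂.regA.memL2W22.1, h₁.regB.memL2W22.1, h₂.regB.memL2W22.1,
    h₁.regS.memL2W22.1, h₂.regS.memL2W22.1, h₁.eqA, h₂.eqA, h₁.eqB, h₂.eqB, h₁.eqS, h₂.eqS,
    h₁.traceA, h₂.traceA, h₁.traceB, h₂.traceB]
    with t wA₁ wA₂ wB₁ wB₂ wS₁ wS₂ eA₁ eA₂ eB₁ eB₂ eS₁ eS₂ tA₁ tA₂ tB₁ tB₂
  obtain ⟨gA₁, gB₁, hgA₁, hgB₁, eS₁⟩ := eS₁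
  obtain ⟨gA₂, gB₂, hgA₂, hgB₂, eS₂⟩ := eS₂
  have iA := inner_sub_laplacian_halfSpace_le upperHalf_eq
    (fun _ => integral_upperHalf_partialDeriv) wA₁ wA₂ tA₁ tA₂ hgA₁ hgA₂
  have iB := inner_sub_laplacian_halfSpace_le lowerHalf_eq
    (fun _ => integral_lowerHalf_partialDeriv) wB₁ wB₂ tB₁ tB₂ hgB₁ hgB₂
  have iS := inner_sub_laplacian_plane_nonpos wS₁ wS₂
  have e : αS • (timeDeriv T θS₁ t - timeDeriv T θS₂ t)
      = κS • (laplacian plane (θS₁ t) - laplacian plane (θS₂ t)) + κA • (gA₁ - gA₂)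
        - κB • (gB₁ - gB₂) := by
    rw [smul_sub, eS₁, eS₂]; module
  have e' : αS * inner ℝ (θS₁ t - θS₂ t) (timeDeriv T θS₁ t - timeDeriv T θS₂ t)
      = κS * inner ℝ (θS₁ t - θS₂ t) (laplacian plane (θS₁ t) - laplacian plane (θS₂ t))
        + κA * inner ℝ (θS₁ t - θS₂ t) (gA₁ - gA₂)
        - κB * inner ℝ (θS₁ t - θS₂ t) (gB₁ - gB₂) := by
    generalize θS₁ t - θS₂ t = w at *
    rw [← real_inner_smul_right, e, inner_sub_right, inner_add_right, real_inner_smul_right,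
      real_inner_smul_right, real_inner_smul_right]
  rw [e', eA₁, eA₂, eB₁, eB₂, ← smul_sub, ← smul_sub, real_inner_smul_right, real_inner_smul_right]
  have mA := mul_le_mul_of_nonneg_left iA hκA.le
  have mB := mul_le_mul_of_nonneg_left iB hκB.le
  have mS := mul_le_mul_of_nonneg_left iS hκS.le
  linarith

/-- The integrated energy identities add up to a nonpositive total, while each of the three energies
is nonnegative and `αS > 0`; hence each is zero. -/
theorem IsStrongSolution.unique {κA κB κS αS T : ℝ} (hκA : 0 < κA) (hκB : 0 < κB)
    (hκS : 0 < κS) (hαS : 0 < αS) (hT : 0 < T)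
    {θA₀ : L2 upperHalf} {θB₀ : L2 lowerHalf} {θS₀ : L2 plane}
    {θA₁ θA₂ : ℝ → L2 upperHalf} {θB₁ θB₂ : ℝ → L2 lowerHalf} {θS₁ θS₂ : ℝ → L2 plane}
    (h₁ : IsStrongSolution κA κB κS αS T θA₀ θB₀ θS₀ θA₁ θB₁ θS₁)
    (h₂ : IsStrongSolution κA κB κS αS T θA₀ θB₀ θS₀ θA₂ θB₂ θS₂) {t : ℝ} (ht : t ∈ Ico 0 T) :
    θA₁ t = θA₂ t ∧ θB₁ t = θB₂ t ∧ θS₁ t = θS₂ t := by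
  have eA := h₁.regA.norm_sub_sq hT h₂.regA (h₁.initA.trans h₂.initA.symm) ht
  have eB := h₁.regB.norm_sub_sq hT h₂.regB (h₁.initB.trans h₂.initB.symm) ht
  have eS := h₁.regS.norm_sub_sq hT h₂.regS (h₁.initS.trans h₂.initS.symm) ht
  have jA := h₁.regA.integrable_inner_sub h₂.regA ht.2.le
  have jB := h₁.regB.integrable_inner_sub h₂.regB ht.2.le
  have jS := h₁.regS.integrable_inner_sub h₂.regS ht.2.le
  have hle := integral_nonpos_of_ae (ae_mono
    (Measure.restrict_mono (Ioo_subset_Ioo_right ht.2.le) le_rfl)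
    (h₁.energy_dissipation hκA hκB hκS h₂))
  have jAB := integral_add (jA.add jB) (jS.const_mul αS)
  simp only [Pi.add_apply] at jAB
  rw [jAB, integral_add jA jB, integral_const_mul] at hle
  have nA := sq_nonneg ‖θA₁ t - θA₂ t‖
  have nB := sq_nonneg ‖θB₁ t - θB₂ t‖
  have nS := mul_nonneg hαS.le (sq_nonneg ‖θS₁ t - θS₂ t‖)
  have hsum : ‖θA₁ t - θA₂ t‖ ^ 2 + ‖θB₁ t - θB₂ t‖ ^ 2 + αS * ‖θS₁ t - θS₂ t‖ ^ 2 ≤ 0 := by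
    rw [eA, eB, eS]; linarith
  have zA : ‖θA₁ t - θA₂ t‖ ^ 2 = 0 := by linarith
  have zB : ‖θB₁ t - θB₂ t‖ ^ 2 = 0 := by linarith
  have zS : αS * ‖θS₁ t - θS₂ t‖ ^ 2 = 0 := by linarith
  have zS' : ‖θS₁ t - θS₂ t‖ ^ 2 = 0 := (mul_eq_zero.1 zS).resolve_left hαS.ne'
  simp only [ne_eq, OfNat.ofNat_ne_zero, not_false_eq_true, pow_eq_zero_iff, norm_eq_zero,
    sub_eq_zero] at zA zB zS'
  exact ⟨zA, zB, zS'⟩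

end ThreePhaseHeat

end

theorem lemma5p1 (κA κB κS' αS : ℝ) (hκA : 0 < κA) (hκB : 0 < κB) (hκS' : 0 < κS') (hαS : 0 < αS)
    (θA₀ : L2 upperHalf) (θB₀ : L2 lowerHalf) (θS₀ : L2 plane)
    (hA₀ : MemW12 upperHalf θA₀) (hB₀ : MemW12 lowerHalf θB₀) (hS₀ : MemW12 plane θS₀)
    (hγA₀ : HasTrace upperHalf θA₀ θS₀) (hγB₀ : HasTrace lowerHalf θB₀ θS₀)
    (T : ℝ) (hT : 0 < T)
    (θA₁ θA₂ : ℝ → L2 upperHalf) (θB₁ θB₂ : ℝ → L2 lowerHalf) (θS₁ θS₂ : ℝ → L2 plane)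
    (h₁ : IsStrongSolution κA κB (κS' * αS) αS T θA₀ θB₀ θS₀ θA₁ θB₁ θS₁)
    (h₂ : IsStrongSolution κA κB (κS' * αS) αS T θA₀ θB₀ θS₀ θA₂ θB₂ θS₂) :
    ∀ t ∈ Ico 0 T, θA₁ t = θA₂ t ∧ θB₁ t = θB₂ t ∧ θS₁ t = θS₂ t := fun _ ht =>
  h₁.unique hκA hκB (mul_pos hκS' hαS) hαS hT h₂ ht
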